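/- Let $V$ and $E$ be disjoint finite sets (of vertices and edges) and let $\iota : V\times E\to\mathbb{Z}_{\ge 0}$ be a function. An incidence is a triple $(v,e,k)$ with $1\le k\le\iota(v,e)$; it contains $v$ and $e$. Write $\mathcal I$ for the set of incidences. An oriented hypergraph $G=(V,E,\mathcal I,\sigma)$ is given by this data together with an arbitrary function $\sigma:\mathcal I\to\{+1,-1\}$. A path in $G$ is an alternating sequence $a_0,i_1,a_1,\dots,i_m,a_m$ in which the $a_j$ are alternately vertices and edges, $i_j$ is an incidence containing $a_{j-1}$ and $a_j$, and no vertex, edge or incidence is repeated; its end-points are $a_0$ and $a_m$. A circle of length $k\ge 1$ is a sequence $a_0,i_1,a_1,\dots,i_{2k},a_{2k}$ of the same kind with no repetition except $a_0=a_{2k}$; its sign is $(-1)^k\prod_{h=1}^{2k}\sigma(i_h)$. $G$ is balanced if every circle has sign $+1$, and $G$ is balanceable if there is a set of incidences such that negating $\sigma$ on exactly these incidences yields a balanced oriented hypergraph. A cross-theta in $G$ consists of a vertex $v$, an edge $e$ and three paths in $G$, each with end-points $v$ and $e$, any two of which have no vertex or edge other than $v$ and $e$, and no incidence, in common. Theorem.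 An oriented hypergraph $G$ is balanceable if and only if it contains no cross-theta. -/

import Mathlib

/-- A hypergraph with multiple incidences, given by its incidence function: `mult v e` is the
multiplicity of the incidence of the vertex `v` with the edge `e`, and `v` and `e` are
incident when it is nonzero. -/
structure MultiHypergraph (V E : Type*) where
  mult : V → E → ℕ

namespace MultiHypergraph

variable {V E : Type*}

/-- An incidence is a triple `(v, e, k)`, where `k` is one of `mult v e` labels. -/
structure Incidence (H : MultiHypergraph V E) where
  vertex : V
  edge : E
  label : Fin (H.mult vertex edge)

variable {H : MultiHypergraph V E}

/-- The incidence `i` contains the two elements `a` and `b`, one of which is its vertex and the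
other its edge. Consecutive terms of a sequence linked in this way thus alternate between
vertices and edges. -/
def Incidence.Joins (i : H.Incidence) (a b : V ⊕ E) : Prop :=
  (a = Sum.inl i.vertex ∧ b = Sum.inr i.edge) ∨ (a = Sum.inr i.edge ∧ b = Sum.inl i.vertex)

/-- A path `a₀, i₁, a₁, …, iₘ, aₘ`: an alternating sequence of vertices and edges `aⱼ`, with
incidences `iⱼ` containing `aⱼ₋₁` and `aⱼ`, where no vertex, edge or incidence is repeated. -/
structure Path (H : MultiHypergraph V E) where
  length : ℕ
  elt : Fin (length + 1) → V ⊕ E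
  inc : Fin length → H.Incidence
  joins : ∀ j : Fin length, (inc j).Joins (elt j.castSucc) (elt j.succ)
  elt_injective : Function.Injective elt
  inc_injective : Function.Injective inc

namespace Path

/-- The vertices and edges of the path. -/
def elements (P : H.Path) : Set (V ⊕ E) := Set.range P.elt

/-- The vertices and edges of the path other than its two end-points. -/
def interior (P : H.Path) : Set (V ⊕ E) :=
  {a | ∃ j : Fin (P.length + 1), j ≠ 0 ∧ j ≠ Fin.last P.length ∧ P.elt j = a}

/-- The incidences of the path. -/
def incidences (P : H.Path) : Set H.Incidence := Set.range P.inc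

/-- Two paths are internally disjoint if they have nothing in common except possibly
end-points of both. In particular they share no incidence. -/
def InternallyDisjoint (P Q : H.Path) : Prop :=
  Disjoint P.interior Q.elements ∧ Disjoint P.elements Q.interior ∧
    Disjoint P.incidences Q.incidences

end Path

/-- A circle of length `k ≥ 1`: an alternating sequence `a₀, i₁, a₁, …, i₂ₖ, a₂ₖ` of vertices
and edges `aⱼ`, with incidences `iⱼ` containing `aⱼ₋₁` and `aⱼ`, where no vertex, edge or
incidence is repeated except that `a₀ = a₂ₖ`. -/
structure Circle (H : MultiHypergraph V E) where
  length : ℕ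
  length_pos : 0 < length
  elt : Fin (2 * length + 1) → V ⊕ E
  inc : Fin (2 * length) → H.Incidence
  joins : ∀ j : Fin (2 * length), (inc j).Joins (elt j.castSucc) (elt j.succ)
  closed : elt 0 = elt (Fin.last (2 * length))
  elt_injective : Function.Injective fun j : Fin (2 * length) => elt j.castSucc
  inc_injective : Function.Injective inc

/-- The three paths `P 0`, `P 1`, `P 2` form a theta graph with end-points `a` and `b`. -/
structure IsTheta (P : Fin 3 → H.Path) (a b : V ⊕ E) : Prop where
  endpoints_ne : a ≠ b
  first_eq : ∀ t, (P t).elt 0 = a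
  last_eq : ∀ t, (P t).elt (Fin.last (P t).length) = b
  internallyDisjoint : ∀ s t, s ≠ t → (P s).InternallyDisjoint (P t)

/-- The hypergraph contains a cross-theta: a theta graph one of whose end-points is a vertex
while the other is an edge. -/
def ContainsCrossTheta (H : MultiHypergraph V E) : Prop :=
  ∃ (P : Fin 3 → H.Path) (v : V) (e : E), IsTheta P (Sum.inl v) (Sum.inr e)

end MultiHypergraph

/-- An oriented hypergraph: a hypergraph with an orientation `+1` or `-1` of each incidence. -/
structure OrientedHypergraph (V E : Type*) extends MultiHypergraph V E where
  orientation : toMultiHypergraph.Incidence → ℤˣ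

namespace OrientedHypergraph

variable {V E : Type*}

/-- The sign of a circle of length `k`: the product of `(-1) ^ k` and the orientations of its
`2 * k` incidences, that is, the product of the signs `-σ(i) σ(i')` of its adjacencies. -/
def circleSign (G : OrientedHypergraph V E) (C : G.toMultiHypergraph.Circle) : ℤˣ :=
  (-1) ^ C.length * ∏ j, G.orientation (C.inc j)

/-- An oriented hypergraph is balanced if all of its circles are positive. -/
def IsBalanced (G : OrientedHypergraph V E) : Prop :=
  ∀ C : G.toMultiHypergraph.Circle, G.circleSign C = 1

open Classical in
/-- The oriented hypergraph obtained by negating exactly the incidences in `S`. -/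
noncomputable def negate (G : OrientedHypergraph V E) (S : Set G.Incidence) :
    OrientedHypergraph V E where
  toMultiHypergraph := G.toMultiHypergraph
  orientation i := if i ∈ S then -G.orientation i else G.orientation i

/-- An oriented hypergraph is balanceable if some of its incidences can be negated so that the
result is balanced. -/
def IsBalanceable (G : OrientedHypergraph V E) : Prop :=
  ∃ S : Set G.Incidence, (G.negate S).IsBalanced

end OrientedHypergraph

/-! Read the orientations ±1 in `ZMod 4`. A circle of length `k` is positive exactly when its `2k`
weights sum to zero, so `G` is balanceable iff some odd-valued `w` (that is, `2 * w i = 2`) vanishes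
on every circle. A cross-theta forbids this. Its three paths have odd length, hence odd weights; if
these sum pairwise to zero, twice each of them is both 0 and 2. Conversely, `exists_isNeutralOn`
assigns weights one incidence at a time. A new incidence `i` closes circles only with paths joining
its two ends, so it suffices that these paths all have the same weight (`sum_eq_sum_of_prefix`).
Where two of them diverge and first meet again, two segments form a circle of weight zero, and with
the remaining path through `i` they form a theta. As it is not a cross-theta, the segments have even
length and hence equal weight. Exchanging them lengthens the common initial part. -/

namespace MultiHypergraph

variable {V E : Type*} {H : MultiHypergraph V E}

/-! ### Walks as lists of incidences and elements -/

theorem Incidence.Joins.symm {i : H.Incidence} {a b : V ⊕ E} (h : i.Joins a b) : i.Joins b a := by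
  unfold Incidence.Joins at *
  tauto

theorem Incidence.Joins.right_unique {i : H.Incidence} {a b c : V ⊕ E} (h : i.Joins a b)
    (h' : i.Joins a c) : b = c := by
  rcases h with ⟨rfl, rfl⟩ | ⟨rfl, rfl⟩ <;> rcases h' with ⟨h1, rfl⟩ | ⟨h1, rfl⟩ <;> simp_all

/-- `IsWalk a is l b`: there is a walk from `a` to `b` whose successive incidences are `is` and
whose successive elements, without the last one, are `l`. -/
inductive IsWalk (H : MultiHypergraph V E) :
    V ⊕ E → List H.Incidence → List (V ⊕ E) → V ⊕ E → Prop
  | nil (a : V ⊕ E) : IsWalk H a [] [] a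
  | cons {a b c : V ⊕ E} {i : H.Incidence} {is : List H.Incidence} {l : List (V ⊕ E)} :
      i.Joins a b → IsWalk H b is l c → IsWalk H a (i :: is) (a :: l) c

namespace IsWalk

variable {a b c : V ⊕ E} {is js : List H.Incidence} {l m : List (V ⊕ E)}

theorem append (h : H.IsWalk a is l b) (h' : H.IsWalk b js m c) :
    H.IsWalk a (is ++ js) (l ++ m) c := by
  induction h with
  | nil a => exact h'
  | cons hi _ ih => exact .cons hi (ih h')

theorem isLeft_eq_iff (h : H.IsWalk a is l b) : a.isLeft = b.isLeft ↔ Even is.length := by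
  induction h with
  | nil a => simp
  | cons hi _ ih =>
    rw [List.length_cons, Nat.even_add_one, ← ih]
    rcases hi with ⟨rfl, rfl⟩ | ⟨rfl, rfl⟩ <;> simp

theorem head_mem (h : H.IsWalk a is l b) : a ∈ l ++ [b] := by
  cases h <;> simp

theorem exists_append_singleton (h : H.IsWalk a is l b) : ∃ r, l ++ [b] = a :: r := by
  cases h
  · exact ⟨[], rfl⟩
  · exact ⟨_, rfl⟩

/-- The incidences of a walk contain only elements of the walk. -/
theorem mem_of_mem_incidences (h : H.IsWalk a is l b) {k : H.Incidence} (hk : k ∈ is) :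
    Sum.inl k.vertex ∈ l ++ [b] ∧ Sum.inr k.edge ∈ l ++ [b] := by
  induction h with
  | nil a => simp at hk
  | cons hi hw ih =>
    rcases List.mem_cons.1 hk with rfl | hk
    · have := hw.head_mem
      rcases hi with ⟨rfl, rfl⟩ | ⟨rfl, rfl⟩ <;> simp_all
    · have := ih hk
      simp_all

/-- The element list omits the end of the walk, so only the list completed by its end reverses
cleanly. -/
theorem reverse_aux (h : H.IsWalk a is l b) :
    ∃ l', H.IsWalk b is.reverse l' a ∧ l' ++ [a] = (l ++ [b]).reverse := by
  induction h with
  | nil a => exact ⟨[], .nil a, rfl⟩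
  | @cons a b c i is l hi hw ih =>
    obtain ⟨l', h1, h2⟩ := ih
    refine ⟨l' ++ [b], ?_, ?_⟩
    · rw [List.reverse_cons]
      exact h1.append (.cons hi.symm (.nil a))
    · rw [h2]; simp

theorem reverse (h : H.IsWalk a is (a :: m) b) :
    H.IsWalk b is.reverse (b :: m.reverse) a := by
  obtain ⟨l', h1, h2⟩ := h.reverse_aux
  have : l' = b :: m.reverse := by
    have h3 : l' ++ [a] = (b :: m.reverse) ++ [a] := by rw [h2]; simp
    exact List.append_cancel_right h3
  rwa [this] at h1

/-- An incidence contains the element it leaves from, so using it again would repeat that element.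
-/
theorem nodup_incidences (h : H.IsWalk a is l b) (hl : (l ++ [b]).Nodup) : is.Nodup := by
  induction h with
  | nil a => simp
  | @cons a b c i is l hi hw ih =>
    rw [List.cons_append, List.nodup_cons] at hl
    refine List.nodup_cons.2 ⟨fun hmem => hl.1 ?_, ih hl.2⟩
    have := hw.mem_of_mem_incidences hmem
    rcases hi with ⟨rfl, rfl⟩ | ⟨rfl, rfl⟩
    exacts [this.1, this.2]

/-- Splitting a walk at one of its elements. -/
theorem split (h : H.IsWalk a is l b) (hc : c ∈ l ++ [b]) :
    ∃ is₁ is₂ l₁ l₂, is = is₁ ++ is₂ ∧ l = l₁ ++ l₂ ∧ H.IsWalk a is₁ l₁ c ∧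
      H.IsWalk c is₂ l₂ b := by
  induction h with
  | nil a =>
    obtain rfl : c = a := by simpa using hc
    exact ⟨[], [], [], [], rfl, rfl, .nil _, .nil _⟩
  | @cons a b d i is l hi hw ih =>
    by_cases hca : c = a
    · subst hca
      exact ⟨[], _, [], _, rfl, rfl, .nil _, .cons hi hw⟩
    · obtain ⟨is₁, is₂, l₁, l₂, rfl, rfl, h1, h2⟩ := ih (by simpa [hca] using hc)
      exact ⟨i :: is₁, is₂, a :: l₁, l₂, rfl, rfl, .cons hi h1, h2⟩

/-- Splitting a walk at its first element in a given set. -/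
theorem split_first (h : H.IsWalk a is l b) (S : Set (V ⊕ E)) (hb : b ∈ S) :
    ∃ c ∈ S, ∃ is₁ is₂ l₁ l₂, is = is₁ ++ is₂ ∧ l = l₁ ++ l₂ ∧ H.IsWalk a is₁ l₁ c ∧
      H.IsWalk c is₂ l₂ b ∧ ∀ d ∈ l₁, d ∉ S := by
  induction h with
  | nil a => exact ⟨a, hb, [], [], [], [], rfl, rfl, .nil _, .nil _, by simp⟩
  | @cons a b d i is l hi hw ih =>
    by_cases ha : a ∈ S
    · exact ⟨a, ha, [], _, [], _, rfl, rfl, .nil _, .cons hi hw, by simp⟩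
    · obtain ⟨c, hc, is₁, is₂, l₁, l₂, rfl, rfl, h1, h2, h3⟩ := ih hb
      exact ⟨c, hc, i :: is₁, is₂, a :: l₁, l₂, rfl, rfl, .cons hi h1, h2, by simp_all⟩

/-- Splitting a walk at one of its incidences. -/
theorem split_incidence (h : H.IsWalk a is l b) {i : H.Incidence} (hi : i ∈ is) :
    ∃ is₁ is₂ l₁ l₂ c d, is = is₁ ++ i :: is₂ ∧ l = l₁ ++ c :: l₂ ∧ H.IsWalk a is₁ l₁ c ∧
      i.Joins c d ∧ H.IsWalk d is₂ l₂ b := by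
  induction h with
  | nil a => simp at hi
  | @cons a b e j is l hj hw ih =>
    rcases List.mem_cons.1 hi with rfl | hi
    · exact ⟨[], _, [], _, a, b, rfl, rfl, .nil _, hj, hw⟩
    · obtain ⟨is₁, is₂, l₁, l₂, c, d, rfl, rfl, h1, h2, h3⟩ := ih hi
      exact ⟨j :: is₁, is₂, a :: l₁, l₂, c, d, rfl, rfl, .cons hj h1, h2, h3⟩

theorem ofFn {n : ℕ} (elt : Fin (n + 1) → V ⊕ E) (inc : Fin n → H.Incidence)
    (h : ∀ j : Fin n, (inc j).Joins (elt j.castSucc) (elt j.succ)) :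
    H.IsWalk (elt 0) (List.ofFn inc) (List.ofFn fun j : Fin n => elt j.castSucc)
      (elt (Fin.last n)) := by
  induction n with
  | zero => simpa using .nil _
  | succ n ih =>
    rw [List.ofFn_succ, List.ofFn_succ]
    exact .cons (h 0) (ih (fun j => elt j.succ) (fun j => inc j.succ) fun j => h j.succ)

theorem exists_ofFn (h : H.IsWalk a is l b) {n : ℕ} (hn : is.length = n) :
    ∃ (elt : Fin (n + 1) → V ⊕ E) (inc : Fin n → H.Incidence),
      (∀ j : Fin n, (inc j).Joins (elt j.castSucc) (elt j.succ)) ∧ elt 0 = a ∧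
      elt (Fin.last n) = b ∧ List.ofFn inc = is ∧
      List.ofFn (fun j : Fin n => elt j.castSucc) = l := by
  induction h generalizing n with
  | nil a =>
    subst hn
    exact ⟨fun _ => a, Fin.elim0, fun j => j.elim0, rfl, rfl, rfl, rfl⟩
  | @cons a b e j is l hj hw ih =>
    subst hn
    obtain ⟨elt, inc, h1, h2, h3, h4, h5⟩ := ih rfl
    refine ⟨Fin.cons a elt, Fin.cons j inc, ?_, rfl, ?_, ?_, ?_⟩
    · intro k
      refine Fin.cases ?_ (fun k => ?_) k
      · simpa [h2] using hj
      · simpa using h1 k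
    · exact h3
    · simp [List.ofFn_succ, h4]
    · simpa [List.ofFn_succ] using h5

end IsWalk

/-! ### Paths with given ends, and theta graphs -/

/-- `IsLink a is m b`: there is a path from `a` to `b ≠ a` with incidences `is` and successive
interior elements `m`. -/
structure IsLink (H : MultiHypergraph V E) (a : V ⊕ E) (is : List H.Incidence)
    (m : List (V ⊕ E)) (b : V ⊕ E) : Prop where
  isWalk : H.IsWalk a is (a :: m) b
  nodup : (a :: m ++ [b]).Nodup

namespace IsLink

variable {a b : V ⊕ E} {is : List H.Incidence} {m : List (V ⊕ E)}

theorem reverse (h : H.IsLink a is m b) : H.IsLink b is.reverse m.reverse a where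
  isWalk := h.isWalk.reverse
  nodup := by
    have : b :: m.reverse ++ [a] = (a :: m ++ [b]).reverse := by simp
    rw [this, List.nodup_reverse]
    exact h.nodup

theorem exists_path (h : H.IsLink a is m b) : ∃ P : H.Path, P.elt 0 = a ∧
    P.elt (Fin.last P.length) = b ∧ (∀ c, c ∈ P.interior ↔ c ∈ m) ∧
    (∀ c, c ∈ P.elements ↔ c = a ∨ c ∈ m ∨ c = b) ∧ ∀ i, i ∈ P.incidences ↔ i ∈ is := by
  obtain ⟨elt, inc, h1, h2, h3, h4, h5⟩ := h.isWalk.exists_ofFn rfl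
  have h6 : List.ofFn elt = a :: m ++ [b] := by
    rw [List.ofFn_succ', h5, h3]
    simp [List.concat_eq_append]
  have hinj : Function.Injective elt := List.nodup_ofFn.1 (h6 ▸ h.nodup)
  have hincs : Function.Injective inc :=
    List.nodup_ofFn.1 (h4.symm ▸ h.isWalk.nodup_incidences h.nodup)
  have hmem : ∀ c, c ∈ Set.range elt ↔ c = a ∨ c ∈ m ∨ c = b := fun c => by
    rw [Set.mem_range, ← List.mem_ofFn, h6]; simp
  refine ⟨⟨is.length, elt, inc, h1, hinj, hincs⟩, h2, h3, fun c => ?_, hmem, fun i => ?_⟩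
  · have hnd := h.nodup
    have key : c ∈ m ↔ c ∈ Set.range elt ∧ c ≠ a ∧ c ≠ b := by
      rw [hmem]
      simp only [List.cons_append, List.nodup_cons, List.mem_append, List.nodup_append] at hnd
      constructor
      · intro hc
        refine ⟨.inr (.inl hc), ?_, ?_⟩
        · rintro rfl; exact hnd.1 (.inl hc)
        · exact hnd.2.2.2 c hc b (by simp)
      · tauto
    rw [key]
    constructor
    · rintro ⟨j, hj0, hj1, rfl⟩
      exact ⟨⟨j, rfl⟩, fun h => hj0 (hinj (h.trans h2.symm)), fun h => hj1 (hinj (h.trans h3.symm))⟩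
    · rintro ⟨⟨j, rfl⟩, ha, hb⟩
      exact ⟨j, fun h => ha (h ▸ h2), fun h => hb (h ▸ h3), rfl⟩
  · have := List.mem_ofFn (f := inc) (a := i)
    rw [h4] at this
    exact this.symm

end IsLink

theorem Path.isLink (P : H.Path) {a b : V ⊕ E} (hab : a ≠ b) (ha : P.elt 0 = a)
    (hb : P.elt (Fin.last P.length) = b) : ∃ is m, H.IsLink a is m b ∧
      (∀ c ∈ m, c ∈ P.interior) ∧ ∀ i ∈ is, i ∈ P.incidences := by
  have hw := IsWalk.ofFn P.elt P.inc P.joins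
  have hnd := List.nodup_ofFn.2 P.elt_injective
  rw [List.ofFn_succ', List.concat_eq_append, hb] at hnd
  rw [ha, hb] at hw
  have hmem : ∀ c ∈ List.ofFn (fun j : Fin P.length => P.elt j.castSucc), c ∈ P.elements :=
    fun c hc => by
      obtain ⟨j, rfl⟩ := List.mem_ofFn.1 hc
      exact ⟨_, rfl⟩
  generalize hl : List.ofFn (fun j : Fin P.length => P.elt j.castSucc) = l at *
  cases l with
  | nil =>
    generalize List.ofFn P.inc = is at hw
    cases hw
    exact absurd rfl hab
  | cons x m =>
    obtain rfl : a = x := by generalize List.ofFn P.inc = is at hw; cases hw; rfl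
    refine ⟨_, m, ⟨hw, hnd⟩, fun c hc => ?_, fun i hi => List.mem_ofFn.1 hi⟩
    obtain ⟨j, rfl⟩ := hmem c (List.mem_cons_of_mem _ hc)
    refine ⟨j, ?_, ?_, rfl⟩
    · rintro rfl
      rw [ha] at hc
      simp_all
    · rintro rfl
      rw [hb] at hc
      exact (List.nodup_append.1 hnd).2.2 b (List.mem_cons_of_mem _ hc) b (by simp) rfl

/-- Two paths without common elements except their common end-points form a circle. -/
theorem IsLink.isWalk_append_reverse {a b : V ⊕ E} {is js : List H.Incidence}
    {l m : List (V ⊕ E)} (h : H.IsLink a is l b) (h' : H.IsLink a js m b) (hlm : l.Disjoint m)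
    (hd : is.Disjoint js) :
    H.IsWalk a (is ++ js.reverse) (a :: l ++ b :: m.reverse) a ∧
      (a :: l ++ b :: m.reverse).Nodup ∧ (is ++ js.reverse).Nodup := by
  refine ⟨h.isWalk.append h'.isWalk.reverse, ?_, ?_⟩
  · have h1 := h.nodup
    have h2 := h'.nodup
    simp only [List.cons_append, List.nodup_cons, List.mem_append, List.nodup_append,
      List.mem_cons, List.mem_reverse, List.nodup_reverse] at *
    grind [List.Disjoint]
  · rw [List.nodup_append']
    exact ⟨h.isWalk.nodup_incidences h.nodup,
      List.nodup_reverse.2 (h'.isWalk.nodup_incidences h'.nodup), by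
        intro i hi hj
        exact hd hi (List.mem_reverse.1 hj)⟩

theorem containsCrossTheta_of_isLink_vertex_edge {v : V} {e : E} {I : Fin 3 → List H.Incidence}
    {M : Fin 3 → List (V ⊕ E)} (h : ∀ t, H.IsLink (Sum.inl v) (I t) (M t) (Sum.inr e))
    (hM : Pairwise fun s t => (M s).Disjoint (M t)) (hI : Pairwise fun s t => (I s).Disjoint (I t)) :
    H.ContainsCrossTheta := by
  choose P h1 h2 h3 h4 h5 using fun t => (h t).exists_path
  have hnd : ∀ t, Sum.inl v ∉ M t ∧ Sum.inr e ∉ M t := fun t => by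
    have := (h t).nodup
    simp [List.nodup_append] at this
    grind
  refine ⟨P, v, e, by simp, h1, h2, fun s t hst => ⟨?_, ?_, ?_⟩⟩
  · rw [Set.disjoint_left]
    intro c hc hc'
    rw [h3] at hc
    rcases (h4 _ _).1 hc' with rfl | hc' | rfl
    exacts [(hnd s).1 hc, hM hst hc hc', (hnd s).2 hc]
  · rw [Set.disjoint_left]
    intro c hc' hc
    rw [h3] at hc
    rcases (h4 _ _).1 hc' with rfl | hc' | rfl
    exacts [(hnd t).1 hc, hM hst hc' hc, (hnd t).2 hc]
  · rw [Set.disjoint_left]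
    intro i hi hi'
    rw [h5] at hi hi'
    exact hI hst hi hi'

/-- Odd length forces one end to be a vertex and the other an edge; reversing the paths if necessary
puts the vertex first. -/
theorem containsCrossTheta_of_isLink {a b : V ⊕ E} {I : Fin 3 → List H.Incidence}
    {M : Fin 3 → List (V ⊕ E)} (h : ∀ t, H.IsLink a (I t) (M t) b)
    (hM : Pairwise fun s t => (M s).Disjoint (M t)) (hI : Pairwise fun s t => (I s).Disjoint (I t))
    (hodd : ¬ Even (I 0).length) : H.ContainsCrossTheta := by
  have hab := (h 0).isWalk.isLeft_eq_iff.not.2 hodd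
  rcases a with v | e <;> rcases b with v' | e' <;> simp at hab
  · exact containsCrossTheta_of_isLink_vertex_edge h hM hI
  · refine containsCrossTheta_of_isLink_vertex_edge (fun t => (h t).reverse) ?_ ?_
    · intro s t hst c hc hc'
      exact hM hst (List.mem_reverse.1 hc) (List.mem_reverse.1 hc')
    · intro s t hst c hc hc'
      exact hI hst (List.mem_reverse.1 hc) (List.mem_reverse.1 hc')

theorem ContainsCrossTheta.exists_isLink (h : H.ContainsCrossTheta) :
    ∃ (a b : V ⊕ E) (I : Fin 3 → List H.Incidence) (M : Fin 3 → List (V ⊕ E)),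
      a.isLeft ≠ b.isLeft ∧ (∀ t, H.IsLink a (I t) (M t) b) ∧
      (Pairwise fun s t => (M s).Disjoint (M t)) ∧ Pairwise fun s t => (I s).Disjoint (I t) := by
  obtain ⟨P, v, e, hP⟩ := h
  choose I M h1 h2 h3 using fun t => (P t).isLink hP.endpoints_ne (hP.first_eq t) (hP.last_eq t)
  refine ⟨_, _, I, M, by simp, h1, fun s t hst c hc hc' => ?_, fun s t hst c hc hc' => ?_⟩
  · obtain ⟨j, -, -, hj⟩ := h2 t c hc'
    exact Set.disjoint_left.1 (hP.internallyDisjoint s t hst).1 (h2 s c hc) ⟨j, hj⟩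
  · exact Set.disjoint_left.1 (hP.internallyDisjoint s t hst).2.2 (h3 s c hc) (h3 t c hc')

/-! ### Weights modulo 4 -/

/-- All circles with incidences in `T` have weight zero. -/
def IsNeutralOn (w : H.Incidence → ZMod 4) (T : Set H.Incidence) : Prop :=
  ∀ ⦃a is l⦄, H.IsWalk a is l a → l.Nodup → is.Nodup → (∀ j ∈ is, j ∈ T) → (is.map w).sum = 0

/-- Weights are odd, so twice a sum depends only on the parity of the number of terms. -/
theorem two_mul_sum_map {w : H.Incidence → ZMod 4} (hw : ∀ i, 2 * w i = 2)
    (is : List H.Incidence) : 2 * (is.map w).sum = 2 * (is.length : ZMod 4) := by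
  induction is with
  | nil => simp
  | cons i is ih => simp [mul_add, hw, ih, add_comm]

theorem two_mul_natCast_of_even {n : ℕ} (hn : Even n) : 2 * (n : ZMod 4) = 0 := by
  obtain ⟨k, rfl⟩ := hn
  push_cast
  linear_combination (k : ZMod 4) * (by decide : (4 : ZMod 4) = 0)

theorem two_mul_natCast_of_odd {n : ℕ} (hn : ¬ Even n) : 2 * (n : ZMod 4) = 2 := by
  obtain ⟨k, rfl⟩ := Nat.not_even_iff_odd.1 hn
  push_cast
  linear_combination (k : ZMod 4) * (by decide : (4 : ZMod 4) = 0)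

/-- Walks with at most one common element have no common incidence. -/
theorem IsWalk.disjoint_incidences {a b c d q : V ⊕ E} {is js : List H.Incidence}
    {l m : List (V ⊕ E)} (h : H.IsWalk a is l b) (h' : H.IsWalk c js m d)
    (hq : ∀ x ∈ l ++ [b], x ∈ m ++ [d] → x = q) : is.Disjoint js := by
  intro k hk hk'
  have h1 := h.mem_of_mem_incidences hk
  have h2 := h'.mem_of_mem_incidences hk'
  -- The vertex and the edge of `k` would both equal `q`.
  have h3 := (hq _ h1.1 h2.1).trans (hq _ h1.2 h2.2).symm
  simp at h3

/-- In a path only the first incidence contains the first element. -/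
theorem IsWalk.eq_of_mem_of_head {a b : V ⊕ E} {i k : H.Incidence} {is : List H.Incidence}
    {l : List (V ⊕ E)} (h : H.IsWalk a (i :: is) (a :: l) b) (ha : a ∉ l ++ [b])
    (hk : k ∈ i :: is) (hak : a = Sum.inl k.vertex ∨ a = Sum.inr k.edge) : k = i := by
  rcases List.mem_cons.1 hk with rfl | hk
  · rfl
  · cases h with
    | cons hi hw =>
      have := hw.mem_of_mem_incidences hk
      rcases hak with rfl | rfl
      exacts [absurd this.1 ha, absurd this.2 ha]

/-- Internally disjoint paths with different first incidences have no common incidence. -/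
theorem IsLink.disjoint_incidences {a b : V ⊕ E} {i j : H.Incidence} {is js : List H.Incidence}
    {l m : List (V ⊕ E)} (h : H.IsLink a (i :: is) l b) (h' : H.IsLink a (j :: js) m b)
    (hlm : l.Disjoint m) (hij : i ≠ j) : (i :: is).Disjoint (j :: js) := by
  intro k hk hk'
  have h1 := h.isWalk.mem_of_mem_incidences hk
  have h2 := h'.isWalk.mem_of_mem_incidences hk'
  have key : ∀ x, x ∈ a :: l ++ [b] → x ∈ a :: m ++ [b] → x = a ∨ x = b := by
    intro x hx hx'
    have := @hlm x
    simp only [List.cons_append, List.mem_cons, List.mem_append, List.not_mem_nil, or_false]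
      at hx hx'
    tauto
  -- A common incidence has both its elements in `{a, b}`, so one of them is `a`.
  have hak : a = Sum.inl k.vertex ∨ a = Sum.inr k.edge := by
    rcases key _ h1.1 h2.1 with h3 | h3
    · exact .inl h3.symm
    · rcases key _ h1.2 h2.2 with h4 | h4
      · exact .inr h4.symm
      · simpa using h3.trans h4.symm
  have e1 := h.isWalk.eq_of_mem_of_head (List.nodup_cons.1 h.nodup).1 hk hak
  have e2 := h'.isWalk.eq_of_mem_of_head (List.nodup_cons.1 h'.nodup).1 hk' hak
  exact hij (e1.symm.trans e2)

/-- For a path through `z` and then `q`: the segment between them, and the way back from `q` to `z`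
that closes up through the far end and the initial part `p`. -/
theorem _root_.List.nodup_segments {α : Type*} {p l r : List α} {z q : α}
    (h : (p ++ z :: l ++ q :: r).Nodup) :
    (z :: l ++ [q]).Nodup ∧ (q :: (r ++ p) ++ [z]).Nodup ∧
      (∀ x ∈ z :: l ++ [q], x ∈ p ++ [z] → x = z) ∧
      (∀ x ∈ z :: l ++ [q], x ∈ q :: r → x = q) ∧ l.Disjoint (r ++ p).reverse := by
  simp only [List.nodup_append, List.nodup_cons, List.mem_append, List.mem_cons, List.Disjoint,
    List.not_mem_nil, List.nodup_nil, List.mem_reverse, or_false, not_false_eq_true] at h ⊢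
  refine ⟨?_, ?_, ?_, ?_, ?_⟩ <;> grind only

theorem _root_.List.nodup_replace_segment {α : Type*} {p l m r : List α} {z q : α}
    (h : (p ++ z :: l ++ q :: r).Nodup) (h' : (p ++ z :: m).Nodup)
    (hm : ∀ d ∈ m, d ∉ l ∧ d ≠ q ∧ d ∉ r) : (p ++ z :: m ++ q :: r).Nodup := by
  simp only [List.nodup_append, List.nodup_cons, List.mem_append, List.mem_cons] at h h' ⊢
  grind only

/-! ### Exchanging segments of two paths -/

/-- Without a cross-theta, two paths that join the ends of a further incidence and have a
common initial part have the same weight. -/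
theorem sum_eq_sum_of_prefix (hH : ¬ H.ContainsCrossTheta) {w : H.Incidence → ZMod 4}
    (hw : ∀ i, 2 * w i = 2) {T : Set H.Incidence} (hT : H.IsNeutralOn w T) {i : H.Incidence}
    (hi : i ∉ T) {x y : V ⊕ E} (hxy : i.Joins x y) (n : ℕ) {z : V ⊕ E}
    {ps is js : List H.Incidence} {pl l m : List (V ⊕ E)} (hn : js.length ≤ n)
    (hp : H.IsWalk x ps pl z) (h : H.IsWalk z is l y) (h' : H.IsWalk z js m y)
    (hl : (pl ++ l ++ [y]).Nodup) (hm : (pl ++ m ++ [y]).Nodup) (hpT : ∀ j ∈ ps, j ∈ T)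
    (hisT : ∀ j ∈ is, j ∈ T) (hjsT : ∀ j ∈ js, j ∈ T) :
    (is.map w).sum = (js.map w).sum := by
  -- `n` only bounds the rest of the second path, since an exchange may shorten it by several
  -- incidences.
  induction n generalizing z ps is js pl l m with
  | zero =>
    obtain rfl : js = [] := by simpa using hn
    cases h'
    cases h with
    | nil => rfl
    | cons => simp [List.nodup_append] at hl
  | succ n ih =>
    cases h' with
    | nil =>
      cases h with
      | nil => rfl
      | cons => simp [List.nodup_append] at hl
    | @cons _ z₂ _ j js m hj h' =>
    cases h with
    | nil => simp [List.nodup_append] at hm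
    | @cons _ z₁ _ i' is l hi' h =>
    by_cases hij : i' = j
    · subst hij
      obtain rfl := hi'.right_unique hj
      have := ih (ps := ps ++ [i']) (pl := pl ++ [z]) (by simpa using hn)
        (hp.append (.cons hi' (.nil _))) h h' (by simpa using hl) (by simpa using hm)
        (List.forall_mem_append.2 ⟨hpT, by simpa using hisT i' (by simp)⟩)
        (List.forall_mem_cons.1 hisT).2 (List.forall_mem_cons.1 hjsT).2
      simp [this]
    -- `q` is where the second path first returns to the first one after `z`. With parallel
    -- incidences it may be the very next element.
    · obtain ⟨q, hq, js₁, js₂, m₁, m₂, rfl, rfl, hw1, hw2, hdis⟩ :=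
        h'.split_first {c | c ∈ l ++ [y]} (by simp)
      obtain ⟨is₁, is₂, l₁, l₂, rfl, rfl, hv1, hv2⟩ := h.split hq
      obtain ⟨r, hr⟩ := hv2.exists_append_singleton
      have hqr : ∀ c, c ∈ l₂ ∨ c = y ↔ c = q ∨ c ∈ r := fun c => by
        have : c ∈ l₂ ++ [y] ↔ c ∈ q :: r := by rw [hr]
        simpa using this
      have hrl : (pl ++ z :: l₁ ++ q :: r).Nodup := by
        rw [← hr]; simpa using hl
      have hdis' : ∀ d ∈ m₁, d ∉ l₁ ∧ d ≠ q ∧ d ∉ r := by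
        intro d hd
        have h1 := hdis d hd
        have h2 := hqr d
        simp only [Set.mem_ofPred_eq, List.mem_append, List.mem_singleton] at h1
        tauto
      have hm' : (pl ++ z :: m₁).Nodup := by
        have : pl ++ (z :: (m₁ ++ m₂)) ++ [y] = (pl ++ z :: m₁) ++ (m₂ ++ [y]) := by simp
        rw [this] at hm
        exact (List.nodup_append.1 hm).1
      have hmq := List.nodup_replace_segment hrl hm' hdis'
      obtain ⟨f1, f2, f3, f4, f5⟩ := List.nodup_segments hrl
      obtain ⟨g1, -, g3, g4, g5⟩ := List.nodup_segments hmq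
      rw [← List.cons_append, List.forall_mem_append] at hisT hjsT
      have hB : H.IsLink z (i' :: is₁) l₁ q := ⟨.cons hi' hv1, f1⟩
      have hB' : H.IsLink z (j :: js₁) m₁ q := ⟨.cons hj hw1, g1⟩
      have hlm : l₁.Disjoint m₁ := fun d hd hd' => (hdis' d hd').1 hd
      have hinc := hB.disjoint_incidences hB' hlm hij
      -- The third path of the theta: on to `y`, across `i` to `x`, and along the common prefix to
      -- `z`.
      have hW : H.IsWalk q (is₂ ++ i :: ps) (l₂ ++ y :: pl) z :=
        hv2.append (.cons hxy.symm hp)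
      have hW' : l₂ ++ y :: pl = q :: (r ++ pl) := by
        rw [← List.cons_append, ← hr]; simp
      have hL : H.IsLink q (is₂ ++ i :: ps) (r ++ pl) z := ⟨hW' ▸ hW, f2⟩
      -- The first path with its segment replaced now agrees with the second one up to `q`.
      have hrest := ih (ps := ps ++ j :: js₁) (pl := pl ++ z :: m₁) (is := is₂) (js := js₂)
        (l := l₂) (m := m₂)
        (by simp at hn; omega) (hp.append hB'.isWalk) hv2 hw2
        (by rw [List.append_assoc, hr]; exact hmq) (by simpa using hm)
        (List.forall_mem_append.2 ⟨hpT, hjsT.1⟩) hisT.2 hjsT.2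
      obtain ⟨c1, c2, c3⟩ := hB.isWalk_append_reverse hB' hlm hinc
      have hsum := hT c1 c2 c3 (List.forall_mem_append.2 ⟨hisT.1, fun k hk =>
        hjsT.1 k (List.mem_reverse.1 hk)⟩)
      have heven : Even (i' :: is₁).length := by
        by_contra hodd
        have key : ∀ {ks : List H.Incidence} {k : List (V ⊕ E)}, H.IsLink z ks k q →
            (∀ x ∈ z :: k ++ [q], x ∈ pl ++ [z] → x = z) →
            (∀ x ∈ z :: k ++ [q], x ∈ q :: r → x = q) → (∀ j ∈ ks, j ∈ T) →
            ks.Disjoint (is₂ ++ i :: ps).reverse := by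
          intro ks k hk h1 h2 hT j hj hj'
          simp only [List.mem_reverse, List.mem_append, List.mem_cons] at hj'
          rcases hj' with hj' | rfl | hj'
          · exact hk.isWalk.disjoint_incidences hv2 (hr ▸ h2) hj hj'
          · exact hi (hT _ hj)
          · exact hk.isWalk.disjoint_incidences hp h1 hj hj'
        have d0 := key hB f3 f4 hisT.1
        have d1 := key hB' g3 g4 hjsT.1
        refine hH (containsCrossTheta_of_isLink (a := z) (b := q)
          (I := ![i' :: is₁, j :: js₁, (is₂ ++ i :: ps).reverse])
          (M := ![l₁, m₁, (r ++ pl).reverse]) ?_ ?_ ?_ hodd)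
        · intro t
          fin_cases t
          exacts [hB, hB', hL.reverse]
        · intro s t hst
          fin_cases s <;> fin_cases t <;> first | exact absurd rfl hst | skip
          exacts [hlm, f5, hlm.symm, g5, f5.symm, g5.symm]
        · intro s t hst
          fin_cases s <;> fin_cases t <;> first | exact absurd rfl hst | skip
          exacts [hinc, d0, hinc.symm, d1, d0.symm, d1.symm]
      have h2 := (two_mul_sum_map hw (i' :: is₁)).trans (two_mul_natCast_of_even heven)
      rw [List.map_append, List.sum_append, List.map_reverse, List.sum_reverse] at hsum
      rw [← List.cons_append, ← List.cons_append, List.map_append, List.map_append,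
        List.sum_append, List.sum_append, hrest]
      -- The segment weights `s`, `s'` satisfy `2 * s = 0` and `s + s' = 0`, so `s = s'`.
      linear_combination h2 - hsum

/-! ### Construction of the weights, one incidence at a time -/

instance [Finite V] [Finite E] : Finite H.Incidence :=
  Finite.of_injective
    (fun i : H.Incidence => (⟨i.vertex, i.edge, i.label⟩ : Σ v e, Fin (H.mult v e)))
    fun i j h => by
      cases i; cases j
      simp only [Sigma.mk.injEq] at h
      obtain ⟨rfl, h⟩ := h
      simp only [heq_eq_eq, Sigma.mk.injEq] at h
      obtain ⟨rfl, h⟩ := h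
      simp_all

/-- Weight zero needs to be checked only for the circles that begin with a given incidence. -/
theorem IsNeutralOn.insert {w : H.Incidence → ZMod 4} {T : Set H.Incidence}
    (hT : H.IsNeutralOn w T) {i : H.Incidence} {x y : V ⊕ E} (hxy : i.Joins x y)
    (h : ∀ is l, H.IsWalk x is l y → (l ++ [y]).Nodup → (∀ j ∈ is, j ∈ T) →
      w i + (is.map w).sum = 0) : H.IsNeutralOn w (insert i T) := by
  intro a is l hw hl his hmem
  by_cases hi : i ∈ is
  · obtain ⟨is₁, is₂, l₁, l₂, c, d, rfl, rfl, h1, hcd, h2⟩ := hw.split_incidence hi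
    -- Cutting the circle at `i` leaves the path `l₂ ++ l₁` from `d` to `c`.
    have hnd : (l₂ ++ l₁ ++ [c]).Nodup := by
      have : (l₂ ++ l₁ ++ [c]).Perm (l₁ ++ c :: l₂) := by
        rw [List.append_assoc]
        exact List.perm_append_comm.trans (by simp)
      exact this.nodup_iff.2 hl
    have hr := h2.append h1
    have hT' : ∀ j ∈ is₂ ++ is₁, j ∈ T := by
      intro j hj
      have hne : j ≠ i := by
        rintro rfl
        have := (List.perm_middle (l₁ := is₁) (l₂ := is₂) (a := j)).nodup_iff.1 his
        rw [List.nodup_cons] at this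
        exact this.1 (List.perm_append_comm.mem_iff.1 hj)
      refine (Set.mem_insert_iff.1 (hmem j ?_)).resolve_left hne
      simp only [List.mem_append, List.mem_cons] at hj ⊢
      tauto
    have key : w i + ((is₂ ++ is₁).map w).sum = 0 := by
      -- If the circle crosses `i` from `x` to `y`, the remaining path runs from `y` to `x` and must
      -- be reversed.
      rcases hxy with ⟨rfl, rfl⟩ | ⟨rfl, rfl⟩ <;> rcases hcd with ⟨rfl, rfl⟩ | ⟨rfl, rfl⟩
      · obtain ⟨l', h3, h4⟩ := hr.reverse_aux
        simpa [add_comm] using h _ _ h3 (by rw [h4, List.nodup_reverse]; exact hnd)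
          fun j hj => hT' j (List.mem_reverse.1 hj)
      · exact h _ _ hr hnd hT'
      · exact h _ _ hr hnd hT'
      · obtain ⟨l', h3, h4⟩ := hr.reverse_aux
        simpa [add_comm] using h _ _ h3 (by rw [h4, List.nodup_reverse]; exact hnd)
          fun j hj => hT' j (List.mem_reverse.1 hj)
    simp only [List.map_append, List.sum_append, List.map_cons, List.sum_cons] at key ⊢
    linear_combination key
  · exact hT hw hl his fun j hj =>
      (Set.mem_insert_iff.1 (hmem j hj)).resolve_left fun h => hi (h ▸ hj)

theorem IsNeutralOn.congr {w w' : H.Incidence → ZMod 4} {T : Set H.Incidence}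
    (hT : H.IsNeutralOn w T) (h : ∀ i ∈ T, w' i = w i) : H.IsNeutralOn w' T := by
  intro a is l hw hl his hmem
  rw [List.map_congr_left fun i hi => h i (hmem i hi)]
  exact hT hw hl his hmem

theorem exists_isNeutralOn [Finite V] [Finite E] (hH : ¬ H.ContainsCrossTheta)
    (T : Set H.Incidence) : ∃ w : H.Incidence → ZMod 4, (∀ i, 2 * w i = 2) ∧ H.IsNeutralOn w T := by
  classical
  induction T, T.toFinite using Set.Finite.induction_on with
  | empty =>
    refine ⟨fun _ => 1, fun _ => mul_one _, fun a is l _ _ _ h => ?_⟩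
    rw [List.eq_nil_iff_forall_not_mem.2 h]
    simp
  | @insert i T hi _ ih =>
    obtain ⟨w, hw, hT⟩ := ih
    have hxy : i.Joins (Sum.inl i.vertex) (Sum.inr i.edge) := .inl ⟨rfl, rfl⟩
    have hupd : ∀ c : ZMod 4, H.IsNeutralOn (Function.update w i c) T := fun c =>
      hT.congr fun j hj => Function.update_of_ne (ne_of_mem_of_not_mem hj hi) _ _
    by_cases hex : ∃ is l, H.IsWalk (Sum.inl i.vertex) is l (Sum.inr i.edge) ∧
        (l ++ [Sum.inr i.edge]).Nodup ∧ ∀ j ∈ is, j ∈ T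
    · obtain ⟨is, l, h1, h2, h3⟩ := hex
      refine ⟨Function.update w i (-(is.map w).sum), fun j => ?_, (hupd _).insert hxy ?_⟩
      · rcases eq_or_ne j i with rfl | hj
        -- A path from a vertex to an edge has odd length, hence odd weight, so its negative is an
        -- admissible value.
        · have hodd : ¬ Even is.length := h1.isLeft_eq_iff.not.1 (by simp)
          have h4 := (two_mul_sum_map hw is).trans (two_mul_natCast_of_odd hodd)
          rw [Function.update_self]
          linear_combination -h4 - (by decide : (4 : ZMod 4) = 0)
        · rw [Function.update_of_ne hj]
          exact hw j
      · intro js m g1 g2 g3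
        have h4 := sum_eq_sum_of_prefix hH hw hT hi hxy js.length le_rfl (.nil _) h1 g1
          (by simpa using h2) (by simpa using g2) (by simp) h3 g3
        have h5 : js.map (Function.update w i (-(is.map w).sum)) = js.map w :=
          List.map_congr_left fun j hj =>
            Function.update_of_ne (ne_of_mem_of_not_mem (g3 j hj) hi) _ _
        rw [h5, Function.update_self, h4]
        ring
    -- Here `i` lies on no circle within `insert i T`, so any odd value serves.
    · exact ⟨w, hw, hT.insert hxy fun is l h1 h2 h3 => absurd ⟨is, l, h1, h2, h3⟩ hex⟩

/-! ### Circles as closed walks, and necessity -/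

theorem Circle.exists_isWalk (C : H.Circle) : ∃ a l, H.IsWalk a (List.ofFn C.inc) l a ∧
    l.Nodup := by
  have h := IsWalk.ofFn C.elt C.inc C.joins
  rw [← C.closed] at h
  exact ⟨_, _, h, List.nodup_ofFn.2 C.elt_injective⟩

theorem IsWalk.exists_circle {a : V ⊕ E} {is : List H.Incidence} {l : List (V ⊕ E)}
    (h : H.IsWalk a is l a) (hl : l.Nodup) (his : is.Nodup) (hne : is ≠ []) :
    ∃ C : H.Circle, List.ofFn C.inc = is := by
  obtain ⟨k, hk⟩ := h.isLeft_eq_iff.1 rfl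
  rw [← two_mul] at hk
  obtain ⟨elt, inc, h1, h2, h3, h4, h5⟩ := h.exists_ofFn hk
  have hpos : 0 < k := by
    have := List.length_pos_iff.2 hne
    omega
  exact ⟨⟨k, hpos, elt, inc, h1, h2.trans h3.symm, List.nodup_ofFn.1 (h5.symm ▸ hl),
    List.nodup_ofFn.1 (h4.symm ▸ his)⟩, h4⟩

/-- A cross-theta prevents all circles from having weight zero. -/
theorem ContainsCrossTheta.not_isNeutralOn (hH : H.ContainsCrossTheta)
    {w : H.Incidence → ZMod 4} (hw : ∀ i, 2 * w i = 2) : ¬ H.IsNeutralOn w Set.univ := by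
  intro hT
  obtain ⟨a, b, I, M, hab, hL, hM, hI⟩ := hH.exists_isLink
  have key : ∀ s t, s ≠ t → ((I s).map w).sum + ((I t).map w).sum = 0 := fun s t hst => by
    obtain ⟨h1, h2, h3⟩ := (hL s).isWalk_append_reverse (hL t) (hM hst) (hI hst)
    simpa using hT h1 h2 h3 (by simp)
  have hodd : ¬ Even (I 1).length := (hL 1).isWalk.isLeft_eq_iff.not.1 hab
  have h := (two_mul_sum_map hw (I 1)).trans (two_mul_natCast_of_odd hodd)
  -- Adding the relations for the pairs 01 and 12 and subtracting that for 02 isolates twice the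
  -- weight of path 1.
  have h0 : (2 : ZMod 4) = 0 := by
    linear_combination -h + key 0 1 (by decide) + key 1 2 (by decide) - key 0 2 (by decide)
  exact absurd h0 (by decide)

end MultiHypergraph

/-! ### From orientations to weights and back -/

namespace OrientedHypergraph

variable {V E : Type*}

/-- The weight in `ZMod 4` of an incidence: its orientation. -/
def weight (G : OrientedHypergraph V E) (i : G.Incidence) : ZMod 4 :=
  ((G.orientation i : ℤ) : ZMod 4)

theorem two_mul_weight (G : OrientedHypergraph V E) (i : G.Incidence) : 2 * G.weight i = 2 := by
  unfold weight
  rcases Int.units_eq_one_or (G.orientation i) with h | h <;> rw [h] <;> decide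

/-- For signs `u`, `p` the product `(1 - u) * (1 - p)` is 0 or 4, so `u + p = 1 + u * p` modulo 4.
-/
theorem _root_.ZMod.sum_map_units_four (L : List ℤˣ) :
    (L.map fun u : ℤˣ => ((u : ℤ) : ZMod 4)).sum = L.length + ((L.prod : ℤˣ) : ℤ) - 1 := by
  induction L with
  | nil => simp
  | cons u L ih =>
    rw [List.map_cons, List.sum_cons, ih, List.prod_cons, List.length_cons]
    generalize L.prod = p
    have : ∀ u p : ℤˣ, ((u : ℤ) : ZMod 4) + ((p : ℤ) : ZMod 4) =
        1 + (((u * p : ℤˣ) : ℤ) : ZMod 4) := by decide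
    rw [Nat.cast_add_one]
    linear_combination this u p

theorem _root_.ZMod.natCast_two_mul_four (k : ℕ) (p : ℤˣ) :
    ((2 * k : ℕ) : ZMod 4) + ((p : ℤ) : ZMod 4) - 1 = 0 ↔ (-1) ^ k * p = 1 := by
  rcases Nat.even_or_odd k with hk | hk
  · have h := MultiHypergraph.two_mul_natCast_of_even hk
    rw [hk.neg_one_pow]
    push_cast
    rw [h]
    revert p
    decide
  · have h := MultiHypergraph.two_mul_natCast_of_odd (Nat.not_even_iff_odd.2 hk)
    rw [hk.neg_one_pow]
    push_cast
    rw [h]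
    revert p
    decide

theorem circleSign_eq_one_iff (G : OrientedHypergraph V E) (C : G.toMultiHypergraph.Circle) :
    G.circleSign C = 1 ↔ ((List.ofFn C.inc).map G.weight).sum = 0 := by
  have h := ZMod.sum_map_units_four ((List.ofFn C.inc).map G.orientation)
  rw [List.map_map] at h
  change ((List.ofFn C.inc).map G.weight).sum = _ at h
  rw [h, List.length_map, List.length_ofFn, ZMod.natCast_two_mul_four, List.map_ofFn,
    List.prod_ofFn]
  rfl

theorem isBalanced_iff (G : OrientedHypergraph V E) :
    G.IsBalanced ↔ G.toMultiHypergraph.IsNeutralOn G.weight Set.univ := by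
  constructor
  · intro h a is l hw hl his _
    rcases eq_or_ne is [] with rfl | hne
    · simp
    · obtain ⟨C, rfl⟩ := hw.exists_circle hl his hne
      exact (G.circleSign_eq_one_iff C).1 (h C)
  · intro h C
    obtain ⟨a, l, hw, hl⟩ := C.exists_isWalk
    exact (G.circleSign_eq_one_iff C).2 (h hw hl (List.nodup_ofFn.2 C.inc_injective) (by simp))

/-- The only odd elements of `ZMod 4` are ±1, so where the two weights differ they are negatives of
each other. -/
theorem exists_weight_negate_eq (G : OrientedHypergraph V E) {w : G.Incidence → ZMod 4}
    (hw : ∀ i, 2 * w i = 2) : ∃ S, ∀ i, (G.negate S).weight i = w i := by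
  refine ⟨{i | G.weight i ≠ w i}, fun i => ?_⟩
  have h := hw i
  by_cases hi : G.weight i = w i
  · exact (congrArg (fun u : ℤˣ => ((u : ℤ) : ZMod 4)) (if_neg (not_not.2 hi))).trans hi
  · refine (congrArg (fun u : ℤˣ => ((u : ℤ) : ZMod 4)) (if_pos hi)).trans ?_
    unfold weight at hi
    generalize G.orientation i = u at hi ⊢
    generalize w i = c at h hi ⊢
    revert u c
    decide

end OrientedHypergraph

theorem mainTheorem5 {V E : Type*} [Finite V] [Finite E] (G : OrientedHypergraph V E) :
    G.IsBalanceable ↔ ¬ G.toMultiHypergraph.ContainsCrossTheta := by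
  constructor
  · rintro ⟨S, hS⟩ hH
    exact hH.not_isNeutralOn (G.negate S).two_mul_weight ((G.negate S).isBalanced_iff.1 hS)
  · intro hH
    obtain ⟨w, hw, hT⟩ := MultiHypergraph.exists_isNeutralOn hH Set.univ
    obtain ⟨S, hS⟩ := G.exists_weight_negate_eq hw
    exact ⟨S, (G.negate S).isBalanced_iff.2 (hT.congr fun i _ => hS i)⟩
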